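/- Let $n\ge 1$, let $C_{2^n}$ be the cyclic group of order $2^n$, and let $G=\mathrm{Hol}(C_{2^n})=C_{2^n}\rtimes\mathrm{Aut}(C_{2^n})$ be its holomorph, the semidirect product with respect to the natural action of $\mathrm{Aut}(C_{2^n})$ on $C_{2^n}$. Then every irreducible complex representation $\widetilde\rho$ of $G$ has Schur index $1$ with respect to $\mathbb{Q}$. Here the Schur index of $\widetilde\rho$ with respect to $\mathbb{Q}$ is the multiplicity with which $\widetilde\rho$ occurs in $\rho\otimes_{\mathbb{Q}}\mathbb{C}$, where $\rho$ is the irreducible $\mathbb{Q}$-representation of $G$, unique up to isomorphism, for which $\widetilde\rho$ occurs in $\rho\otimes_{\mathbb{Q}}\mathbb{C}$. -/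

import Mathlib

universe uF uK uG uV uW

/-- The holomorph of a group `N`: the semidirect product of `N` with its automorphism group, with
respect to the natural action of `MulAut N` on `N`. -/
abbrev Holomorph (N : Type*) [Group N] : Type _ :=
  N ⋊[MonoidHom.id (MulAut N)] MulAut N

/-- The extension of scalars `K ⊗ ρ` to `K` of a representation `ρ` over `F`; an element `g` acts
on `K ⊗ W` as `id ⊗ ρ g`. -/
noncomputable def Representation.extendScalars {F : Type uF} (K : Type uK) {G : Type uG}
    {W : Type uW} [Field F] [Field K] [Algebra F K] [Group G] [AddCommGroup W] [Module F W]
    (ρ : Representation F G W) : Representation K G (TensorProduct F K W) :=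
  (Module.End.baseChangeHom F K W : Module.End F W →* _).comp ρ

/-- The multiplicity of `τ` in `σ`, as the dimension of the space of `G`-equivariant maps from `τ`
to `σ`. For a finite group `G`, an irreducible `τ` and a finite dimensional `σ` over an
algebraically closed field of characteristic zero, this is the number of summands isomorphic to
`τ` in a decomposition of `σ` into irreducible representations. -/
noncomputable def Representation.multiplicityIn {K : Type uK} {G : Type uG} {V : Type uV}
    {W : Type uW} [Field K] [Group G] [AddCommGroup V] [Module K V] [AddCommGroup W] [Module K W]
    (τ : Representation K G V) (σ : Representation K G W) : ℕ :=
  Module.finrank K (Representation.IntertwiningMap τ σ)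

/-- `τ.HasSchurIndex F m`: the irreducible representation `τ` of the finite group `G`, over an
algebraically closed extension `K` of a field `F` of characteristic zero, has Schur index `m` with
respect to `F`. That is, `τ` occurs in `K ⊗ ρ` for some irreducible `F`-representation `ρ` of `G`,
and whenever it occurs in `K ⊗ ρ` for an irreducible `F`-representation `ρ` of `G`, it does so with
multiplicity exactly `m`. As `G` is finite, irreducible `F`-representations are finite dimensional,
so that up to isomorphism all of them live in the universe of `F`. -/
def Representation.HasSchurIndex (F : Type uF) {K : Type uK} {G : Type uG} {V : Type uV}
    [Field F] [Field K] [Algebra F K] [Group G] [AddCommGroup V] [Module K V]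
    (τ : Representation K G V) (m : ℕ) : Prop :=
  (∃ (W : Type uF) (_ : AddCommGroup W) (_ : Module F W) (ρ : Representation F G W),
      ρ.IsIrreducible ∧ τ.multiplicityIn (ρ.extendScalars K) ≠ 0) ∧
  ∀ (W : Type uF) [AddCommGroup W] [Module F W] (ρ : Representation F G W),
    ρ.IsIrreducible → τ.multiplicityIn (ρ.extendScalars K) ≠ 0 →
      τ.multiplicityIn (ρ.extendScalars K) = m

/-! Suppose a subgroup `H` fixes exactly a line of the irreducible `τ`. If `τ` occurs in `K ⊗ ρ`
with `ρ` irreducible over `F`, then `ρ` has an `H`-fixed vector `w ≠ 0`, and `p ↦ p (1 ⊗ w)` embeds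
the intertwining maps `K ⊗ ρ → τ` into that line; so the multiplicity is one
(`HasSchurIndex.one_of_subgroup`).

To find `H`, write the holomorph as generated by `a`, `s`, `t`, where `s` and `t` act on the
eigenvalues of `a` by fifth power and inversion. Take an eigenvector `v` of `a`, with eigenvalue `ζ`
of order `2 ^ k`. If `k ≤ 1`, `τ` is one-dimensional and `H` is trivial. Otherwise the stabilizer of
`ζ` in `⟨s, t⟩` acts through powers of `s ^ 2 ^ (k - 2)`, and `v` may be taken to be an eigenvector
of this element too, with eigenvalue `ω` of order `2 ^ j`. If `ω = ±1`, a twist of `⟨s, t⟩` by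
powers of `a` permutes the lines of the translates of `v` transitively and no longer sees `ω`. If `j
≥ 2`, a cyclic `H` generated by a twist of `s ^ 2 ^ (j - 2)` works. `exists_fixed_line` turns such
an `H` into a fixed line by averaging `v` over it. -/

namespace Representation

open scoped MonoidAlgebra _root_.TensorProduct

/-! ### Complete reducibility and irreducible representations -/

section Maschke

variable {k G V W : Type*} [Field k] [CharZero k] [Group G] [Finite G] [AddCommGroup V] [Module k V]
  [AddCommGroup W] [Module k W] {ρ : Representation k G V} {σ : Representation k G W}

theorem exists_comp_eq_id_of_injective (f : IntertwiningMap ρ σ) (hf : Function.Injective f) :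
    ∃ p : IntertwiningMap σ ρ, p.comp f = IntertwiningMap.id ρ := by
  obtain ⟨g, hg⟩ := MonoidAlgebra.exists_leftInverse_of_injective
    (IntertwiningMap.equivLinearMapAsModule ρ σ f) (LinearMap.ker_eq_bot.mpr hf)
  refine ⟨(IntertwiningMap.equivLinearMapAsModule σ ρ).symm g, ?_⟩
  ext v
  exact LinearMap.congr_fun hg v

theorem exists_comp_eq_id_of_surjective (f : IntertwiningMap ρ σ) (hf : Function.Surjective f) :
    ∃ i : IntertwiningMap σ ρ, f.comp i = IntertwiningMap.id σ := by
  obtain ⟨g, hg⟩ := IsSemisimpleModule.lifting_property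
    (IntertwiningMap.equivLinearMapAsModule ρ σ f) hf LinearMap.id
  refine ⟨(IntertwiningMap.equivLinearMapAsModule σ ρ).symm g, ?_⟩
  ext v
  exact LinearMap.congr_fun hg v

end Maschke

section Irreducible

variable {k G V : Type*} [Field k] [Group G] [AddCommGroup V] [Module k V]
  {τ : Representation k G V}

theorem IsIrreducible.nontrivial (hτ : τ.IsIrreducible) : Nontrivial V := by
  by_contra h
  rw [not_nontrivial_iff_subsingleton] at h
  obtain ⟨a, b, hab⟩ := hτ.exists_pair_ne
  exact hab (Subrepresentation.toSubmodule_injective (Subsingleton.elim _ _))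

theorem IsIrreducible.eq_top_of_mem (hτ : τ.IsIrreducible) (p : Submodule k V)
    (hp : ∀ g, ∀ v ∈ p, τ g v ∈ p) {v : V} (hv : v ∈ p) (hv0 : v ≠ 0) : p = ⊤ := by
  rcases hτ.eq_bot_or_eq_top ⟨p, hp⟩ with h | h
  · have hp : p = ⊥ := congrArg Subrepresentation.toSubmodule h
    exact absurd ((Submodule.mem_bot k).mp (hp ▸ hv)) hv0
  · exact congrArg Subrepresentation.toSubmodule h

theorem IsIrreducible.span_range_eq_top (hτ : τ.IsIrreducible) {v : V} (hv : v ≠ 0) :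
    Submodule.span k (Set.range fun g ↦ τ g v) = ⊤ := by
  refine hτ.eq_top_of_mem _ (fun g w hw ↦ ?_)
    (Submodule.subset_span ⟨1, by simp⟩ : v ∈ Submodule.span k (Set.range fun g ↦ τ g v)) hv
  induction hw using Submodule.span_induction with
  | mem x hx =>
    obtain ⟨h, rfl⟩ := hx
    exact Submodule.subset_span ⟨g * h, by simp⟩
  | zero => simp
  | add x y _ _ hx hy => simpa using Submodule.add_mem _ hx hy
  | smul c x _ hx => simpa using Submodule.smul_mem _ c hx

theorem IsIrreducible.finiteDimensional [Finite G] (hτ : τ.IsIrreducible) :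
    FiniteDimensional k V := by
  have := hτ.nontrivial
  obtain ⟨v, hv⟩ := exists_ne (0 : V)
  refine ⟨?_⟩
  rw [← hτ.span_range_eq_top hv]
  exact Submodule.fg_span (Set.finite_range _)

end Irreducible

theorem isIrreducible_ofModule' {k G M : Type*} [Field k] [Group G] [AddCommGroup M] [Module k M]
    [Module k[G] M] [IsScalarTower k k[G] M] (hM : IsSimpleModule k[G] M) :
    (ofModule' (k := k) (G := G) M).IsIrreducible := by
  have := IsSimpleModule.nontrivial k[G] M
  refine { exists_pair_ne := ⟨⊥, ⊤, fun h ↦ ?_⟩, eq_bot_or_eq_top := fun p ↦ ?_ }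
  · exact bot_ne_top (congrArg Subrepresentation.toSubmodule h : (⊥ : Submodule k M) = ⊤)
  · let q : Submodule k[G] M :=
      { carrier := p.toSubmodule
        add_mem' := p.toSubmodule.add_mem
        zero_mem' := p.toSubmodule.zero_mem
        smul_mem' := fun r x hx ↦ by
          induction r using MonoidAlgebra.induction_linear with
          | zero => simp
          | add r s hr hs => rw [add_smul]; exact p.toSubmodule.add_mem hr hs
          | single g c =>
            have h : MonoidAlgebra.single g c = c • (MonoidAlgebra.single g 1 : k[G]) := by simp
            rw [h, smul_assoc]
            refine p.toSubmodule.smul_mem c ?_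
            simpa [ofModule'] using p.apply_mem_toSubmodule g hx }
    have hq (x : M) : x ∈ q ↔ x ∈ p.toSubmodule := Iff.rfl
    rcases hM.1.eq_bot_or_eq_top q with h | h
    · left
      apply Subrepresentation.toSubmodule_injective
      ext x
      rw [← hq, h]
      rfl
    · right
      apply Subrepresentation.toSubmodule_injective
      ext x
      rw [← hq, h]
      exact ⟨fun _ ↦ Submodule.mem_top, fun _ ↦ Submodule.mem_top⟩

/-! ### Extension of scalars and the fixed-line criterion -/

section ExtendScalars

variable {F K G W V : Type*} [Field F] [Field K] [Algebra F K] [Group G] [AddCommGroup W]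
  [Module F W] [AddCommGroup V] [Module K V] {ρ : Representation F G W} {τ : Representation K G V}

@[simp] theorem extendScalars_tmul (g : G) (c : K) (w : W) :
    ρ.extendScalars K g (c ⊗ₜ w) = c ⊗ₜ ρ g w := rfl

/-- An intertwining map out of `K ⊗ ρ` which kills `1 ⊗ w` for a nonzero `w` vanishes when `ρ` is
irreducible. -/
theorem eq_zero_of_apply_one_tmul_eq_zero (hρ : ρ.IsIrreducible)
    (p : IntertwiningMap (ρ.extendScalars K) τ) {w : W} (hw : w ≠ 0)
    (h : p ((1 : K) ⊗ₜ[F] w) = 0) : p = 0 := by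
  have key (x : W) : p ((1 : K) ⊗ₜ[F] x) = 0 := by
    have hx : x ∈ Submodule.span F (Set.range fun g ↦ ρ g w) := by
      rw [hρ.span_range_eq_top hw]; trivial
    induction hx using Submodule.span_induction with
    | mem x hx =>
      obtain ⟨g, rfl⟩ := hx
      have := p.isIntertwining _ _ g ((1 : K) ⊗ₜ[F] w)
      rwa [h, map_zero, extendScalars_tmul] at this
    | zero => rw [TensorProduct.tmul_zero, map_zero]
    | add x y _ _ hx hy => rw [TensorProduct.tmul_add, map_add, hx, hy, add_zero]
    | smul c x _ hx =>
      rw [← TensorProduct.smul_tmul, ← algebraMap_smul K c (1 : K), ← TensorProduct.smul_tmul',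
        map_smul, hx, smul_zero]
  ext x
  induction x using TensorProduct.induction_on with
  | zero => simp
  | tmul c x =>
    have : c ⊗ₜ[F] x = c • ((1 : K) ⊗ₜ[F] x) := by
      rw [TensorProduct.smul_tmul', smul_eq_mul, mul_one]
    simp only [IntertwiningMap.coe_toLinearMap]
    rw [this, map_smul, key, smul_zero]
    rfl
  | add x y hx hy => rw [map_add, map_add, hx, hy]

/-- A subgroup `H` that fixes a nonzero vector of `K ⊗ ρ` fixes a nonzero vector of `ρ`. -/
theorem exists_fixed_of_extendScalars [CharZero F] [CharZero K] [Finite G] (H : Subgroup G)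
    {x : K ⊗[F] W} (hx : x ≠ 0) (hfix : ∀ h ∈ H, ρ.extendScalars K h x = x) :
    ∃ w : W, w ≠ 0 ∧ ∀ h ∈ H, ρ h w = w := by
  have := Fintype.ofFinite H
  let e : W →ₗ[F] W := ∑ h : H, ρ h
  have he (h : G) (hh : h ∈ H) (w : W) : ρ h (e w) = e w := by
    simp only [e, LinearMap.sum_apply, map_sum]
    refine Fintype.sum_equiv (Equiv.mulLeft (⟨h, hh⟩ : H)) _ _ fun i ↦ ?_
    simp
  by_contra! hcon
  have h0 (w : W) : e w = 0 := by
    by_contra h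
    obtain ⟨g, hg, hne⟩ := hcon _ h
    exact hne (he g hg w)
  -- The sum over `H` on `K ⊗ ρ` is the base change of `e`, so it vanishes with `e`; on the fixed
  -- vector `x` it is multiplication by the order of `H`.
  have hsum (y : K ⊗[F] W) : ∑ h : H, ρ.extendScalars K (h : G) y = 0 := by
    induction y using TensorProduct.induction_on with
    | zero => simp
    | tmul c w =>
      simp only [extendScalars_tmul, ← TensorProduct.tmul_sum]
      rw [← LinearMap.sum_apply]
      erw [h0 w]
      rw [TensorProduct.tmul_zero]
    | add x y hx hy => simp only [map_add, Finset.sum_add_distrib, hx, hy, add_zero]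
  have := hsum x
  rw [Finset.sum_congr rfl fun (h : H) _ ↦ hfix h h.2, Finset.sum_const, Finset.card_univ,
    ← Nat.cast_smul_eq_nsmul K, smul_eq_zero] at this
  simp [hx] at this

/-- Every irreducible representation over `K` of a finite group is a constituent of `K ⊗ ρ` for an
irreducible representation `ρ` over the subfield `F`. -/
theorem exists_isIrreducible_extendScalars {F : Type uF} {K : Type uK} {G : Type} {V : Type uV}
    [Field F] [Field K] [Algebra F K] [CharZero F] [CharZero K] [Group G] [Finite G]
    [AddCommGroup V] [Module K V] {τ : Representation K G V} (hτ : τ.IsIrreducible) :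
    ∃ (W : Type uF) (_ : AddCommGroup W) (_ : Module F W) (ρ : Representation F G W),
      ρ.IsIrreducible ∧ ∃ f : IntertwiningMap τ (ρ.extendScalars K), f ≠ 0 := by
  have := hτ.nontrivial
  obtain ⟨v, hv⟩ := exists_ne (0 : V)
  let _ : Module F V := Module.compHom V (algebraMap F K)
  have : IsScalarTower F K V := IsScalarTower.of_compHom F K V
  let L : F[G] →ₐ[F] Module.End K V := MonoidAlgebra.lift F (Module.End K V) G τ
  let N : Submodule F[G] F[G] :=
    { carrier := {x | L x v = 0}
      add_mem' := fun {x y} hx hy ↦ by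
        simp only [Set.mem_ofPred_eq] at hx hy ⊢
        rw [map_add, LinearMap.add_apply, hx, hy, add_zero]
      zero_mem' := by simp
      smul_mem' := fun r x hx ↦ by
        simp only [Set.mem_ofPred_eq] at hx ⊢
        rw [smul_eq_mul, map_mul, Module.End.mul_apply, hx, map_zero] }
  -- `N` is the annihilator of `v`. The simple left ideals span `F[G]`, so if all of them killed
  -- `v`, so would `1`.
  have hN : ¬ ∀ S : Submodule F[G] F[G], IsSimpleModule F[G] S → S ≤ N := by
    intro h
    have h1 : (⊤ : Submodule F[G] F[G]) ≤ N := by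
      rw [← IsSemisimpleModule.sSup_simples_eq_top F[G] F[G]]
      exact sSup_le h
    have : L 1 v = 0 := h1 (Submodule.mem_top : (1 : F[G]) ∈ ⊤)
    rw [map_one] at this
    exact hv this
  push Not at hN
  obtain ⟨S, hS, hSN⟩ := hN
  obtain ⟨x, hxS, hxN⟩ := Set.not_subset.mp hSN
  let ρ : Representation F G S := ofModule' S
  have hρg (g : G) (s : S) : ((ρ g s : S) : F[G]) = MonoidAlgebra.of F G g * s := by
    simp [ρ, ofModule']
  let φ : S →ₗ[F] V :=
    { toFun := fun s ↦ L s v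
      map_add' := fun a b ↦ by simp
      map_smul' := fun c a ↦ by simp }
  let p : IntertwiningMap (ρ.extendScalars K) τ :=
    { toLinearMap := TensorProduct.AlgebraTensorModule.lift
        ((LinearMap.toSpanSingleton K (S →ₗ[F] V) φ))
      isIntertwining' := fun g ↦ by
        ext s
        simp [φ, hρg, L] }
  have hp : p ≠ 0 := fun h ↦ hxN <| by
    have := DFunLike.congr_fun h ((1 : K) ⊗ₜ[F] (⟨x, hxS⟩ : S))
    change L x v = 0
    simpa [p, φ] using this
  obtain ⟨i, hi⟩ := exists_comp_eq_id_of_surjective p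
    ((IsIrreducible.surjective_or_eq_zero p).resolve_right hp)
  refine ⟨S, inferInstance, inferInstance, ρ, isIrreducible_ofModule' hS, i, ?_⟩
  rintro rfl
  have := DFunLike.congr_fun hi v
  simp at this
  exact hv this.symm

/-- If a subgroup `H` fixes exactly a line in the irreducible representation `τ`, then `τ` has Schur
index one over every subfield. -/
theorem HasSchurIndex.one_of_subgroup {F : Type uF} {K : Type uK} {G : Type} {V : Type uV}
    [Field F] [Field K] [Algebra F K] [CharZero F] [CharZero K] [IsAlgClosed K] [Group G] [Finite G]
    [AddCommGroup V] [Module K V] {τ : Representation K G V} (hτ : τ.IsIrreducible)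
    (H : Subgroup G) {v₀ : V} (hv₀ : v₀ ≠ 0) (hfix : ∀ h ∈ H, τ h v₀ = v₀)
    (hline : ∀ v, (∀ h ∈ H, τ h v = v) → ∃ c : K, v = c • v₀) :
    τ.HasSchurIndex F 1 := by
  have := hτ.finiteDimensional
  have key (W : Type uF) [AddCommGroup W] [Module F W] (ρ : Representation F G W)
      (hρ : ρ.IsIrreducible) (f : IntertwiningMap τ (ρ.extendScalars K)) (hf : f ≠ 0) :
      τ.multiplicityIn (ρ.extendScalars K) = 1 := by
    have hinj (f : IntertwiningMap τ (ρ.extendScalars K)) (hf : f ≠ 0) : Function.Injective f :=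
      (IsIrreducible.injective_or_eq_zero f).resolve_right hf
    obtain ⟨w, hw, hwfix⟩ := exists_fixed_of_extendScalars (ρ := ρ) H
      ((map_ne_zero_iff f (hinj f hf)).mpr hv₀)
      (fun h hh ↦ by rw [← f.isIntertwining, hfix h hh])
    have hpw (p : IntertwiningMap (ρ.extendScalars K) τ) :
        ∃ c : K, p ((1 : K) ⊗ₜ[F] w) = c • v₀ :=
      hline _ fun h hh ↦ by rw [← p.isIntertwining, extendScalars_tmul, hwfix h hh]
    obtain ⟨p, hp⟩ := exists_comp_eq_id_of_injective f (hinj f hf)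
    obtain ⟨a, ha⟩ := hpw p
    have hp0 : p ≠ 0 := by
      rintro rfl
      have := DFunLike.congr_fun hp v₀
      simp at this
      exact hv₀ this.symm
    have ha0 : a ≠ 0 := by
      rintro rfl
      exact hp0 (eq_zero_of_apply_one_tmul_eq_zero hρ p hw (by rw [ha, zero_smul]))
    refine finrank_eq_one f hf fun f' ↦ ?_
    obtain ⟨c, hc⟩ := (IsIrreducible.algebraMap_intertwiningMap_bijective_of_isAlgClosed
      (ρ := τ)).2 (p.comp f')
    refine ⟨c, ?_⟩
    -- By Schur `p ∘ f' = c`, and `p ∘ f = 1`, so `p` kills `f' - c • f`. If that map were nonzero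
    -- it would have a left inverse `q`; but `q` is a multiple of `p`, both being determined by
    -- their values at `1 ⊗ w`.
    by_contra hne
    obtain ⟨q, hq⟩ := exists_comp_eq_id_of_injective (f' - c • f)
      (hinj _ (sub_ne_zero.mpr (Ne.symm hne)))
    obtain ⟨b, hb⟩ := hpw q
    have hqp : q - (b / a) • p = 0 := by
      refine eq_zero_of_apply_one_tmul_eq_zero hρ _ hw ?_
      rw [IntertwiningMap.coe_sub, Pi.sub_apply, IntertwiningMap.smul_apply, ha, hb, smul_smul,
        div_mul_cancel₀ b ha0, sub_self]
    have h1 := DFunLike.congr_fun hq v₀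
    have h2 := DFunLike.congr_fun hc v₀
    have h3 := DFunLike.congr_fun hp v₀
    rw [sub_eq_zero.mp hqp] at h1
    simp only [IntertwiningMap.comp_apply, IntertwiningMap.smul_apply, IntertwiningMap.coe_sub,
      Pi.sub_apply, IntertwiningMap.id_apply, map_sub, map_smul] at h1 h2 h3
    rw [← h2, h3, Algebra.algebraMap_eq_smul_one] at h1
    apply hv₀
    rw [← h1]
    simp [smul_comm c (b / a)]
  refine ⟨?_, fun W _ _ ρ hρ hne ↦ ?_⟩
  · obtain ⟨W, i₁, i₂, ρ, hρ, f, hf⟩ := exists_isIrreducible_extendScalars (F := F) hτ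
    exact ⟨W, i₁, i₂, ρ, hρ, by rw [key W ρ hρ f hf]; exact one_ne_zero⟩
  · have : ∃ f : IntertwiningMap τ (ρ.extendScalars K), f ≠ 0 := by
      by_contra! h
      have : Subsingleton (IntertwiningMap τ (ρ.extendScalars K)) :=
        ⟨fun f g ↦ by rw [h f, h g]⟩
      exact hne Module.finrank_zero_of_subsingleton
    obtain ⟨f, hf⟩ := this
    exact key W ρ hρ f hf

end ExtendScalars

end Representation

/-! ### Powers of five modulo powers of two -/

section Arithmetic

/-- Lifting the exponent: the 2-adic valuation of `5 ^ y - 1` is that of `y` plus two. -/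
theorem two_pow_dvd_five_pow_sub_one_iff {k : ℕ} (hk : 2 ≤ k) (y : ℕ) :
    (2 : ℤ) ^ k ∣ 5 ^ y - 1 ↔ 2 ^ (k - 2) ∣ y := by
  have h := Int.two_pow_sub_pow' (x := 5) (y := 1) y (by norm_num) (by norm_num)
  have h4 : emultiplicity (2 : ℤ) (5 - 1) = 2 := by
    rw [show (5 - 1 : ℤ) = 2 ^ 2 by norm_num]
    exact emultiplicity_pow_self_of_prime Int.prime_two 2
  rw [one_pow, h4] at h
  obtain ⟨l, rfl⟩ := Nat.exists_eq_add_of_le hk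
  rw [pow_dvd_iff_le_emultiplicity, h, Nat.cast_add, Nat.cast_ofNat,
    (ENat.addLECancellable_of_ne_top (a := 2) (ENat.natCast_ne_top 2)).add_le_add_iff_left,
    ← pow_dvd_iff_le_emultiplicity, Nat.add_sub_cancel_left]
  norm_cast

theorem five_pow_mod_four (y : ℕ) : (5 : ℤ) ^ y ≡ 1 [ZMOD 4] := by
  have : (5 : ℤ) ≡ 1 [ZMOD 4] := by decide
  simpa using this.pow y

/-- If `ε * 5 ^ y` is congruent to `1` modulo `2 ^ k`, where `ε = ±1`, then `ε = 1` and `2 ^ (k - 2)`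
divides `y`. -/
theorem two_pow_dvd_neg_one_pow_mul_five_pow_sub_one {k : ℕ} (hk : 2 ≤ k) {y z : ℕ}
    (h : (2 : ℤ) ^ k ∣ (-1) ^ z * 5 ^ y - 1) : Even z ∧ 2 ^ (k - 2) ∣ y := by
  rcases Nat.even_or_odd z with hz | hz
  · refine ⟨hz, ?_⟩
    rw [hz.neg_one_pow, one_mul] at h
    exact (two_pow_dvd_five_pow_sub_one_iff hk y).mp h
  · rw [hz.neg_one_pow] at h
    have h4 : (4 : ℤ) ∣ -1 * 5 ^ y - 1 := (pow_dvd_pow (2 : ℤ) hk).trans h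
    have := (five_pow_mod_four y).dvd
    omega

theorem exists_odd_five_pow_two_pow_sub_one {k : ℕ} (hk : 2 ≤ k) :
    ∃ b : ℤ, Odd b ∧ (5 : ℤ) ^ 2 ^ (k - 2) - 1 = 2 ^ k * b := by
  obtain ⟨b, hb⟩ := (two_pow_dvd_five_pow_sub_one_iff hk (2 ^ (k - 2))).mpr dvd_rfl
  refine ⟨b, ?_, hb⟩
  rw [← Int.not_even_iff_odd]
  rintro ⟨d, rfl⟩
  have : (2 : ℤ) ^ (k + 1) ∣ 5 ^ 2 ^ (k - 2) - 1 := ⟨d, by rw [hb]; ring⟩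
  rw [two_pow_dvd_five_pow_sub_one_iff (by omega),
    Nat.pow_dvd_pow_iff_le_right (by norm_num)] at this
  omega

/-- The sum of the powers `5 ^ (2 ^ (j - 2) * i)` for `i < 2 ^ (m - j)` is `2 ^ (m - j)` times an odd
number. -/
theorem exists_odd_sum_five_pow {j m : ℕ} (hj : 2 ≤ j) (hjm : j ≤ m) :
    ∃ b : ℤ, Odd b ∧
      ∑ i ∈ Finset.range (2 ^ (m - j)), (5 : ℤ) ^ (2 ^ (j - 2) * i) = 2 ^ (m - j) * b := by
  obtain ⟨b, hb, hb'⟩ := exists_odd_five_pow_two_pow_sub_one hj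
  obtain ⟨c, hc, hc'⟩ := exists_odd_five_pow_two_pow_sub_one (hj.trans hjm)
  obtain ⟨d, rfl⟩ := Nat.exists_eq_add_of_le hjm
  -- The sum is the quotient of `5 ^ 2 ^ (m - 2) - 1` by `5 ^ 2 ^ (j - 2) - 1`, whose valuations are
  -- exactly `m` and `j`.
  have hgeom := geom_sum_mul ((5 : ℤ) ^ 2 ^ (j - 2)) (2 ^ d)
  simp only [← pow_mul] at hgeom
  rw [← pow_add, show j - 2 + d = j + d - 2 by omega, hb', hc', pow_add, mul_left_comm, mul_assoc,
    mul_right_inj' (by positivity)] at hgeom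
  rw [Nat.add_sub_cancel_left]
  have hdvd : (2 : ℤ) ^ d ∣ ∑ i ∈ Finset.range (2 ^ d), (5 : ℤ) ^ (2 ^ (j - 2) * i) :=
    (Int.isCoprime_two_left.mpr hb).pow_left.dvd_of_dvd_mul_right ⟨c, hgeom⟩
  obtain ⟨e, he⟩ := hdvd
  refine ⟨e, ?_, he⟩
  rw [he, mul_assoc, mul_right_inj' (by positivity)] at hgeom
  rw [← hgeom] at hc
  exact (Int.odd_mul.mp hc).1

/-- Every integer congruent to `1` modulo `4` is a power of `5` modulo `2 ^ n`, up to inversion. -/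
theorem exists_mul_five_pow_modEq_one {x : ℤ} (hx : x ≡ 1 [ZMOD 4]) (n : ℕ) :
    ∃ y : ℕ, (2 : ℤ) ^ n ∣ x * 5 ^ y - 1 := by
  induction n with
  | zero => exact ⟨0, by simp⟩
  | succ n ih =>
    obtain ⟨y, c, hc⟩ := ih
    have h4 : (4 : ℤ) ∣ x * 5 ^ y - 1 := by
      simpa using (hx.mul (five_pow_mod_four y)).symm.dvd
    by_cases hn : n < 2
    · exact ⟨y, (pow_dvd_pow (2 : ℤ) (show n + 1 ≤ 2 by omega)).trans h4⟩
    rcases Int.even_or_odd c with ⟨d, hd⟩ | hodd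
    · exact ⟨y, d, by rw [hc, hd]; ring⟩
    · push Not at hn
      obtain ⟨b, hbo, hb⟩ := exists_odd_five_pow_two_pow_sub_one hn
      obtain ⟨d, hd⟩ := hodd.add_odd hbo
      -- `(1 + 2 ^ n * c) * (1 + 2 ^ n * b)` is `1 + 2 ^ n * (c + b)` plus a multiple of `2 ^ (2 *
      -- n)`, and `c + b` is even.
      refine ⟨y + 2 ^ (n - 2), d + 2 ^ (n - 1) * c * b, ?_⟩
      have e1 : x * 5 ^ y = 1 + 2 ^ n * c := by linarith
      have e2 : (5 : ℤ) ^ 2 ^ (n - 2) = 1 + 2 ^ n * b := by linarith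
      obtain ⟨m, rfl⟩ := Nat.exists_eq_add_of_le hn
      rw [pow_add, ← mul_assoc, e1, e2]
      rw [show 2 + m - 1 = m + 1 by omega]
      linear_combination (2 : ℤ) ^ (2 + m) * hd

end Arithmetic

/-! ### Averaging an eigenvector to a fixed line -/

namespace Representation

variable {K G V : Type*} [Field K] [Group G] [AddCommGroup V] [Module K V]

theorem apply_pow_of_eigenvector {τ : Representation K G V} {a : G} {x : V} {μ : K} (hx : τ a x = μ • x) (i : ℕ) :
    τ (a ^ i) x = μ ^ i • x := by
  induction i with
  | zero => simp
  | succ i ih =>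
    rw [pow_succ, map_mul, Module.End.mul_apply, hx, map_smul, ih, smul_smul, pow_succ, mul_comm]

theorem pow_eq_one_of_eigenvector {τ : Representation K G V} {a : G} {x : V} {μ : K}
    (hx : τ a x = μ • x) (hx0 : x ≠ 0) {i : ℕ} (ha : a ^ i = 1) : μ ^ i = 1 := by
  have h := apply_pow_of_eigenvector hx i
  rw [ha, map_one, Module.End.one_apply] at h
  by_contra hne
  refine hx0 ((smul_eq_zero.mp (?_ : (μ ^ i - 1) • x = 0)).resolve_left (sub_ne_zero.mpr hne))
  rw [sub_smul, ← h, one_smul, sub_self]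

/-- The orbit of a vector `v` under a subgroup `H` averages to a spanning vector of the `H`-fixed
vectors, as soon as the `H`-orbit of `v` meets, up to scalars, every translate of `v` on which no
element of `H` acts by a nontrivial scalar. -/
theorem exists_fixed_line [CharZero K] [Finite G] {τ : Representation K G V}
    (H : Subgroup G) (a : G) {v : V} {ζ : K} (ha : τ a v = ζ • v) (hv : v ≠ 0)
    (hspan : Submodule.span K (Set.range fun g ↦ τ g v) = ⊤)
    (h₁ : ∀ h ∈ H, τ h v = v ∨ ∃ μ : K, μ ≠ ζ ∧ τ a (τ h v) = μ • τ h v)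
    (h₂ : ∀ g, (∃ h ∈ H, ∃ c : K, τ g v = c • τ h v) ∨
      ∃ h ∈ H, ∃ c : K, c ≠ 1 ∧ τ h (τ g v) = c • τ g v) :
    ∃ v₀ : V, v₀ ≠ 0 ∧ (∀ h ∈ H, τ h v₀ = v₀) ∧
      ∀ w, (∀ h ∈ H, τ h w = w) → ∃ c : K, w = c • v₀ := by
  classical
  have := Fintype.ofFinite H
  have hζ := pow_eq_one_of_eigenvector ha hv (pow_orderOf_eq_one a)
  have hN : orderOf a ≠ 0 := (isOfFinOrder_of_finite a).orderOf_pos.ne'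
  have hζ0 : ζ ≠ 0 := by
    rintro rfl
    rw [zero_pow hN] at hζ
    exact zero_ne_one hζ
  -- Up to the factor `orderOf a`, the projector onto the `ζ`-eigenspace of `a`.
  let P : V →ₗ[K] V := ∑ i ∈ Finset.range (orderOf a), (ζ⁻¹ ^ i) • τ (a ^ i)
  have hP (x : V) (μ : K) (hx : τ a x = μ • x) :
      P x = (∑ i ∈ Finset.range (orderOf a), (ζ⁻¹ * μ) ^ i) • x := by
    simp only [P, LinearMap.sum_apply, LinearMap.smul_apply, apply_pow_of_eigenvector hx, Finset.sum_smul, smul_smul,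
      mul_pow]
  have hPv : P v = (orderOf a : K) • v := by
    rw [hP v ζ ha, inv_mul_cancel₀ hζ0]
    simp
  have hPμ (x : V) (μ : K) (hμ : μ ≠ ζ) (hx : τ a x = μ • x) : P x = 0 := by
    by_cases hx0 : x = 0
    · rw [hx0, map_zero]
    rw [hP x μ hx, geom_sum_eq, mul_pow, pow_eq_one_of_eigenvector hx hx0 (pow_orderOf_eq_one a), inv_pow, hζ]
    · simp
    · intro h
      exact hμ (by rw [← mul_one ζ, ← h, mul_inv_cancel_left₀ hζ0])
  let e : V →ₗ[K] V := ∑ h : H, τ h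
  have he (h : G) (hh : h ∈ H) (w : V) : τ h (e w) = e w := by
    simp only [e, LinearMap.sum_apply, map_sum]
    refine Fintype.sum_equiv (Equiv.mulLeft (⟨h, hh⟩ : H)) _ _ fun i ↦ ?_
    simp
  have he' (h : G) (hh : h ∈ H) (w : V) : e (τ h w) = e w := by
    simp only [e, LinearMap.sum_apply]
    refine Fintype.sum_equiv (Equiv.mulRight (⟨h, hh⟩ : H)) _ _ fun i ↦ ?_
    simp
  -- By `h₁`, `P` kills every term of `e v` other than those equal to `v`, so `P (e v)` is a
  -- positive multiple of `v`: the term of `1 : H` is among them.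
  have hev : e v ≠ 0 := by
    intro h
    have h0 : P (e v) = 0 := by rw [h, map_zero]
    simp only [e, LinearMap.sum_apply, map_sum] at h0
    have hterm (i : H) : P (τ i v) = if τ i v = v then (orderOf a : K) • v else 0 := by
      split_ifs with hi
      · rw [hi, hPv]
      · obtain ⟨μ, hμ, hx⟩ := (h₁ i i.2).resolve_left hi
        exact hPμ _ μ hμ hx
    rw [Finset.sum_congr rfl fun i _ ↦ hterm i, ← Finset.sum_filter, Finset.sum_const,
      ← Nat.cast_smul_eq_nsmul K, smul_smul, smul_eq_zero, or_iff_left hv, ← Nat.cast_mul,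
      Nat.cast_eq_zero, mul_eq_zero, or_iff_left hN, Finset.card_eq_zero] at h0
    exact Finset.notMem_empty (1 : H) (h0 ▸ Finset.mem_filter.mpr ⟨Finset.mem_univ _, by simp⟩)
  refine ⟨e v, hev, fun h hh ↦ he h hh v, fun w hw ↦ ?_⟩
  have hline (x : V) : ∃ c : K, e x = c • e v := by
    have hx : x ∈ Submodule.span K (Set.range fun g ↦ τ g v) := by rw [hspan]; trivial
    induction hx using Submodule.span_induction with
    | mem x hx =>
      obtain ⟨g, rfl⟩ := hx
      rcases h₂ g with ⟨h, hh, c, hc⟩ | ⟨h, hh, c, hc, hg⟩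
      · exact ⟨c, by simp only [hc, map_smul, he' h hh]⟩
      · refine ⟨0, ?_⟩
        have := he' h hh (τ g v)
        rw [hg, map_smul] at this
        rw [zero_smul]
        refine (smul_eq_zero.mp (?_ : (c - 1) • e (τ g v) = 0)).resolve_left (sub_ne_zero.mpr hc)
        rw [sub_smul, this, one_smul, sub_self]
    | zero => exact ⟨0, by simp⟩
    | add x y _ _ hx hy =>
      obtain ⟨c, hc⟩ := hx
      obtain ⟨d, hd⟩ := hy
      exact ⟨c + d, by rw [map_add, hc, hd, add_smul]⟩
    | smul b x _ hx =>
      obtain ⟨c, hc⟩ := hx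
      exact ⟨b * c, by rw [map_smul, hc, smul_smul]⟩
  obtain ⟨c, hc⟩ := hline w
  have hew : e w = (Fintype.card H : K) • w := by
    simp only [e, LinearMap.sum_apply]
    rw [Finset.sum_congr rfl fun (i : H) _ ↦ hw i i.2, Finset.sum_const, Finset.card_univ,
      Nat.cast_smul_eq_nsmul]
  refine ⟨(Fintype.card H : K)⁻¹ * c, ?_⟩
  rw [← smul_smul, ← hc, hew, smul_smul, inv_mul_cancel₀ (by simp), one_smul]

end Representation

/-! ### Relations in the holomorph -/

/-- The relations, satisfied in the holomorph of the cyclic group of order `2 ^ n`, between a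
generator `a` of the cyclic group and the automorphisms `s` and `t` with `s⁻¹ a s = a ^ 5` and
`t⁻¹ a t = a⁻¹`. -/
structure HolomorphRelations {G : Type*} [Group G] (n : ℕ) (a s t : G) : Prop where
  a_pow : a ^ 2 ^ n = 1
  s_pow : s ^ 2 ^ n = 1
  t_mul_t : t * t = 1
  s_mul_t : s * t = t * s
  a_mul_s : a * s = s * a ^ 5
  a_mul_t : a * t = t * a⁻¹
  exists_eq (g : G) : ∃ x y z : ℕ, g = s ^ y * t ^ z * a ^ x

/-- Moving `a` to the right gives `s * t * a ^ (-3 * d)` for both products, since `-d + 2 * (-d)`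
equals `-5 * d + 2 * d`. -/
theorem HolomorphRelations.commute {G : Type*} [Group G] {n : ℕ} {a s t : G}
    (hR : HolomorphRelations n a s t) (d : ℕ) :
    Commute (s * a ^ (2 * d)) (t * (a ^ d)⁻¹) := by
  have h1 (i : ℕ) : a ^ i * t = t * (a ^ i)⁻¹ := by
    have : SemiconjBy t a⁻¹ a := hR.a_mul_t.symm
    simpa using (this.pow_right i).eq.symm
  have h1' (i : ℕ) : (a ^ i)⁻¹ * t = t * a ^ i := by
    rw [inv_mul_eq_iff_eq_mul, ← mul_assoc, h1, inv_mul_cancel_right]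
  have h2 (i : ℕ) : a ^ i * s = s * a ^ (5 * i) := by
    have : SemiconjBy s (a ^ 5) a := hR.a_mul_s.symm
    rw [pow_mul]
    exact (this.pow_right i).eq.symm
  have h2' (i : ℕ) : (a ^ i)⁻¹ * s = s * (a ^ (5 * i))⁻¹ := by
    rw [inv_mul_eq_iff_eq_mul, ← mul_assoc, h2, mul_inv_cancel_right]
  change s * a ^ (2 * d) * (t * (a ^ d)⁻¹) = t * (a ^ d)⁻¹ * (s * a ^ (2 * d))
  calc s * a ^ (2 * d) * (t * (a ^ d)⁻¹) = s * (a ^ (2 * d) * t) * (a ^ d)⁻¹ := by group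
    _ = (s * t) * ((a ^ (2 * d))⁻¹ * (a ^ d)⁻¹) := by rw [h1]; group
    _ = t * s * ((a ^ (5 * d))⁻¹ * a ^ (2 * d)) := by
      rw [hR.s_mul_t]; group
    _ = t * ((a ^ d)⁻¹ * s) * a ^ (2 * d) := by rw [h2']; group
    _ = t * (a ^ d)⁻¹ * (s * a ^ (2 * d)) := by group

theorem HolomorphRelations.t_mul_sq {G : Type*} [Group G] {n : ℕ} {a s t : G}
    (hR : HolomorphRelations n a s t) (d : ℕ) :
    (t * (a ^ d)⁻¹) ^ 2 = 1 := by
  have h1 : a ^ d * t = t * (a ^ d)⁻¹ := by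
    have : SemiconjBy t a⁻¹ a := hR.a_mul_t.symm
    simpa using (this.pow_right d).eq.symm
  rw [sq, ← h1, mul_assoc, h1, ← mul_assoc t, hR.t_mul_t, one_mul, mul_inv_cancel]

theorem Subgroup.exists_eq_of_mem_closure_pair {G : Type*} [Group G] [Finite G] {g h x : G} (hgh : Commute g h)
    (hx : x ∈ Subgroup.closure {g, h}) : ∃ y z : ℕ, x = g ^ y * h ^ z := by
  induction hx using Subgroup.closure_induction with
  | mem x hx =>
    rcases hx with rfl | rfl
    · exact ⟨1, 0, by simp⟩
    · exact ⟨0, 1, by simp⟩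
  | one => exact ⟨0, 0, by simp⟩
  | mul x x' _ _ hx hx' =>
    obtain ⟨y, z, rfl⟩ := hx
    obtain ⟨y', z', rfl⟩ := hx'
    refine ⟨y + y', z + z', ?_⟩
    rw [pow_add, pow_add, mul_assoc, mul_assoc, ← mul_assoc (h ^ z),
      ((hgh.pow_pow y' z).eq).symm, mul_assoc]
  | inv x _ hx =>
    obtain ⟨y, z, rfl⟩ := hx
    obtain ⟨i, hi⟩ : ∃ i : ℕ, (g ^ y * h ^ z) ^ i = (g ^ y * h ^ z)⁻¹ :=
      mem_powers_iff_mem_zpowers.mpr (Subgroup.inv_mem _ (Subgroup.mem_zpowers _))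
    refine ⟨y * i, z * i, ?_⟩
    rw [← hi, (hgh.pow_pow y z).mul_pow, pow_mul, pow_mul]

theorem Module.End.exists_eigenvector_mem {K V : Type*} [Field K] [IsAlgClosed K] [AddCommGroup V]
    [Module K V] [FiniteDimensional K V] (f : Module.End K V) (p : Submodule K V)
    (hp : ∃ x ∈ p, x ≠ 0) (hf : ∀ x ∈ p, f x ∈ p) :
    ∃ μ : K, ∃ v ∈ p, v ≠ 0 ∧ f v = μ • v := by
  obtain ⟨x, hx, hx0⟩ := hp
  have : Nontrivial p := ⟨⟨x, hx⟩, 0, fun h ↦ hx0 (congrArg Subtype.val h)⟩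
  obtain ⟨μ, hμ⟩ := Module.End.exists_eigenvalue (f.restrict hf)
  obtain ⟨v, hv⟩ := hμ.exists_hasEigenvector
  exact ⟨μ, v, v.2, fun h ↦ hv.2 (Subtype.ext h), congrArg Subtype.val hv.apply_eq_smul⟩

/-! ### Action of the generators on eigenvectors of `a` -/

namespace Representation

section Eigenvectors

variable {K G V : Type*} [Field K] [Group G] [AddCommGroup V] [Module K V]
  {τ : Representation K G V}

theorem apply_inv_of_eigenvector {a : G} {x : V} {μ : K} (hμ : μ ≠ 0) (hx : τ a x = μ • x) :
    τ a⁻¹ x = μ⁻¹ • x := by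
  have h : τ a⁻¹ (τ a x) = x := by simp
  rw [hx, map_smul] at h
  rw [← h, smul_smul, inv_mul_cancel₀ hμ, one_smul, h]

theorem apply_zpow_of_eigenvector {a : G} {x : V} {μ : K} (hμ : μ ≠ 0) (hx : τ a x = μ • x)
    (i : ℤ) : τ (a ^ i) x = μ ^ i • x := by
  cases i with
  | ofNat i => simpa using apply_pow_of_eigenvector hx i
  | negSucc i =>
    rw [zpow_negSucc, zpow_negSucc, ← inv_pow, ← inv_pow]
    exact apply_pow_of_eigenvector (apply_inv_of_eigenvector hμ hx) _

variable {n : ℕ} {a s t : G} {ζ : K}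

theorem eigenvector_s (hR : HolomorphRelations n a s t) {w : V} {μ : K} (hw : τ a w = μ • w) :
    τ a (τ s w) = μ ^ 5 • τ s w := by
  rw [← Module.End.mul_apply, ← map_mul, hR.a_mul_s, map_mul, Module.End.mul_apply,
    apply_pow_of_eigenvector hw, map_smul]

theorem eigenvector_t (hR : HolomorphRelations n a s t) {w : V} {μ : K} (hμ : μ ≠ 0)
    (hw : τ a w = μ • w) : τ a (τ t w) = μ⁻¹ • τ t w := by
  rw [← Module.End.mul_apply, ← map_mul, hR.a_mul_t, map_mul, Module.End.mul_apply,
    apply_inv_of_eigenvector hμ hw, map_smul]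

theorem eigenvector_s_pow (hR : HolomorphRelations n a s t) {w : V} {u : ℤ}
    (hw : τ a w = ζ ^ u • w) (y : ℕ) : τ a (τ (s ^ y) w) = ζ ^ (u * 5 ^ y) • τ (s ^ y) w := by
  induction y with
  | zero => simpa using hw
  | succ y ih =>
    rw [pow_succ', map_mul, Module.End.mul_apply, eigenvector_s hR ih, ← zpow_natCast, ← zpow_mul,
      pow_succ, mul_assoc]
    rfl

theorem eigenvector_t_pow (hR : HolomorphRelations n a s t) (hζ : ζ ≠ 0) {w : V} {u : ℤ}
    (hw : τ a w = ζ ^ u • w) (z : ℕ) : τ a (τ (t ^ z) w) = ζ ^ (u * (-1) ^ z) • τ (t ^ z) w := by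
  induction z with
  | zero => simpa using hw
  | succ z ih =>
    rw [pow_succ', map_mul, Module.End.mul_apply, eigenvector_t hR (zpow_ne_zero _ hζ) ih,
      ← zpow_neg, pow_succ, mul_neg_one, mul_neg]

theorem eigenvector_s_pow_mul_t_pow (hR : HolomorphRelations n a s t) (hζ : ζ ≠ 0) {v : V}
    (hv : τ a v = ζ • v) (y z : ℕ) :
    τ a (τ (s ^ y * t ^ z) v) = ζ ^ ((-1) ^ z * 5 ^ y : ℤ) • τ (s ^ y * t ^ z) v := by
  have h := eigenvector_t_pow hR hζ (u := 1) (by rwa [zpow_one]) z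
  rw [map_mul, Module.End.mul_apply, eigenvector_s_pow hR h, one_mul]

/-- The `l`-th factor `a ^ c` meets the vector `τ (s ^ (q * l)) w`, whose eigenvalue is `ζ ^ (u * 5
^ (q * l))`; the scalars accumulate to a geometric sum. -/
theorem apply_s_pow_mul_a_zpow_pow (hR : HolomorphRelations n a s t) (hζ : ζ ≠ 0) {w : V} {u : ℤ}
    (hw : τ a w = ζ ^ u • w) (q : ℕ) (c : ℤ) (i : ℕ) :
    τ ((s ^ q * a ^ c) ^ i) w =
      ζ ^ (u * c * ∑ l ∈ Finset.range i, (5 : ℤ) ^ (q * l)) • τ (s ^ (q * i)) w := by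
  induction i with
  | zero => simp
  | succ i ih =>
    rw [pow_succ', map_mul, Module.End.mul_apply, ih, map_smul, map_mul, Module.End.mul_apply,
      apply_zpow_of_eigenvector (zpow_ne_zero _ hζ) (eigenvector_s_pow hR hw _), map_smul,
      ← Module.End.mul_apply, ← map_mul, ← pow_add, smul_smul, ← zpow_mul, ← zpow_add₀ hζ,
      Finset.sum_range_succ]
    congr 2
    · ring
    · rw [mul_add_one, add_comm]

end Eigenvectors

/-! ### The subgroup `H` in each case -/

section SchurIndex

variable {F : Type uF} {K : Type uK} {G : Type} {V : Type uV} [Field F] [Field K] [Algebra F K]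
  [CharZero F] [CharZero K] [IsAlgClosed K] [Group G] [Finite G] [AddCommGroup V] [Module K V]
  {τ : Representation K G V} {n : ℕ} {a s t : G} {ζ : K} {v : V}

/-- Powers of `a` only rescale `v`, so the translates by `s ^ y * t ^ z` suffice in
`exists_fixed_line`. -/
theorem hasSchurIndex_one_of_eigenvector (hR : HolomorphRelations n a s t) (hτ : τ.IsIrreducible)
    (hv : v ≠ 0) (ha : τ a v = ζ • v) (H : Subgroup G)
    (h₁ : ∀ h ∈ H, τ h v = v ∨ ∃ μ : K, μ ≠ ζ ∧ τ a (τ h v) = μ • τ h v)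
    (h₂ : ∀ y z : ℕ, (∃ h ∈ H, ∃ c : K, τ (s ^ y * t ^ z) v = c • τ h v) ∨
      ∃ h ∈ H, ∃ c : K, c ≠ 1 ∧ τ h (τ (s ^ y * t ^ z) v) = c • τ (s ^ y * t ^ z) v) :
    τ.HasSchurIndex F 1 := by
  obtain ⟨v₀, hv₀, hfix, hline⟩ := exists_fixed_line H a ha hv (hτ.span_range_eq_top hv) h₁
    (fun g ↦ by
      obtain ⟨x, y, z, rfl⟩ := hR.exists_eq g
      have hx : τ (s ^ y * t ^ z * a ^ x) v = ζ ^ x • τ (s ^ y * t ^ z) v := by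
        rw [map_mul, Module.End.mul_apply, apply_pow_of_eigenvector ha, map_smul]
      rw [hx]
      rcases h₂ y z with ⟨h, hh, c, hc⟩ | ⟨h, hh, c, hc, hg⟩
      · exact .inl ⟨h, hh, ζ ^ x * c, by rw [hc, smul_smul]⟩
      · exact .inr ⟨h, hh, c, hc, by rw [map_smul, hg, smul_comm]⟩)
  exact HasSchurIndex.one_of_subgroup hτ H hv₀ hfix hline

/-- As `ζ ^ 5 = ζ⁻¹ = ζ`, the commuting `s` and `t` preserve the eigenspace of `a`. A common
eigenvector of all three spans `V`, and the trivial subgroup serves as `H`. -/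
theorem hasSchurIndex_one_of_sq_eq_one (hR : HolomorphRelations n a s t) (hτ : τ.IsIrreducible)
    (hv : v ≠ 0) (ha : τ a v = ζ • v) (hζ : ζ ^ 2 = 1) : τ.HasSchurIndex F 1 := by
  have := hτ.finiteDimensional
  have hζ0 : ζ ≠ 0 := by rintro rfl; simp at hζ
  have hζ5 : ζ ^ 5 = ζ := by linear_combination (ζ ^ 3 + ζ) * hζ
  have hζi : ζ⁻¹ = ζ := inv_eq_of_mul_eq_one_left (by rw [← sq, hζ])
  let p := Module.End.eigenspace (τ a) ζ
  have hp (x : V) : x ∈ p ↔ τ a x = ζ • x := Module.End.mem_eigenspace_iff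
  obtain ⟨α, w, hwp, hw0, hw⟩ := Module.End.exists_eigenvector_mem (τ s) p ⟨v, (hp v).mpr ha, hv⟩
    (fun x hx ↦ by rw [hp] at hx ⊢; rw [eigenvector_s hR hx, hζ5])
  let q := p ⊓ Module.End.eigenspace (τ s) α
  have hq (x : V) : x ∈ q ↔ τ a x = ζ • x ∧ τ s x = α • x := by
    rw [Submodule.mem_inf, hp, Module.End.mem_eigenspace_iff]
  obtain ⟨β, x, hxq, hx0, hx⟩ := Module.End.exists_eigenvector_mem (τ t) q
    ⟨w, (hq w).mpr ⟨(hp w).mp hwp, hw⟩, hw0⟩ (fun x hx ↦ by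
      rw [hq] at hx ⊢
      refine ⟨by rw [eigenvector_t hR hζ0 hx.1, hζi], ?_⟩
      rw [← Module.End.mul_apply, ← map_mul, hR.s_mul_t, map_mul, Module.End.mul_apply, hx.2,
        map_smul])
  rw [hq] at hxq
  refine hasSchurIndex_one_of_eigenvector hR hτ hx0 hxq.1 ⊥ (fun h hh ↦ .inl ?_) fun y z ↦ .inl ?_
  · rw [Subgroup.mem_bot.mp hh, map_one, Module.End.one_apply]
  · refine ⟨1, Subgroup.mem_bot.mpr rfl, β ^ z * α ^ y, ?_⟩
    rw [map_mul, Module.End.mul_apply, apply_pow_of_eigenvector hx, map_smul,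
      apply_pow_of_eigenvector hxq.2, smul_smul, map_one, Module.End.one_apply]

/-- Here `H` is generated by the commuting twists `g` of `s` and `h` of `t`. Up to scalars it moves
`v` as `s` and `t` do, so it reaches every translate; the twist is chosen so that elements of `H`
preserving the eigenvalue `ζ` fix `v`. -/
theorem hasSchurIndex_one_of_eq_neg_one_pow (hR : HolomorphRelations n a s t)
    (hτ : τ.IsIrreducible) (hv : v ≠ 0) (ha : τ a v = ζ • v) {k : ℕ} (hk : 2 ≤ k)
    (hζ : IsPrimitiveRoot ζ (2 ^ k)) (d : ℕ) (hs : τ (s ^ 2 ^ (k - 2)) v = (-1 : K) ^ d • v) :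
    τ.HasSchurIndex F 1 := by
  have hζ0 : ζ ≠ 0 := hζ.ne_zero (by positivity)
  have hcomm := hR.commute d
  have hsq := hR.t_mul_sq d
  set g := s * a ^ (2 * d) with hg
  set h := t * (a ^ d)⁻¹ with hh
  have hgpow {w : V} {u : ℤ} (hw : τ a w = ζ ^ u • w) (i : ℕ) :
      τ (g ^ i) w = ζ ^ (u * (2 * d) * ∑ l ∈ Finset.range i, (5 : ℤ) ^ l) • τ (s ^ i) w := by
    have := apply_s_pow_mul_a_zpow_pow hR hζ0 hw 1 (2 * d : ℕ) i
    rw [zpow_natCast, pow_one, ← hg] at this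
    simpa only [one_mul, Nat.cast_mul, Nat.cast_ofNat] using this
  have hv1 : τ a v = ζ ^ (1 : ℤ) • v := by rwa [zpow_one]
  have hhpow (z : ℕ) : ∃ e : ℤ, τ (h ^ z) v = ζ ^ e • τ (t ^ z) v := by
    induction z with
    | zero => exact ⟨0, by simp⟩
    | succ z ih =>
      obtain ⟨e, he⟩ := ih
      have := eigenvector_t_pow hR hζ0 hv1 z
      refine ⟨e + (1 * (-1) ^ z) * -(d : ℤ), ?_⟩
      rw [pow_succ', map_mul, Module.End.mul_apply, he, map_smul, hh, ← zpow_natCast, ← zpow_neg,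
        map_mul, Module.End.mul_apply, apply_zpow_of_eigenvector (zpow_ne_zero _ hζ0) this,
        map_smul, smul_smul, ← zpow_mul, ← zpow_add₀ hζ0, pow_succ' t, map_mul,
        Module.End.mul_apply]
  have hgh (y z : ℕ) : ∃ e : ℤ, τ (g ^ y * h ^ z) v = ζ ^ e • τ (s ^ y * t ^ z) v := by
    obtain ⟨e, he⟩ := hhpow z
    refine ⟨e + 1 * (-1) ^ z * (2 * d) * ∑ l ∈ Finset.range y, (5 : ℤ) ^ l, ?_⟩
    rw [map_mul, Module.End.mul_apply, he, map_smul, hgpow (eigenvector_t_pow hR hζ0 hv1 z),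
      smul_smul, ← zpow_add₀ hζ0, map_mul, Module.End.mul_apply]
  -- The twist contributes `ζ ^ (2 * d * 2 ^ (k - 2) * b)` with `b` odd, which is `(-1) ^ d` and
  -- cancels the eigenvalue of `s ^ 2 ^ (k - 2)`.
  have hgN : τ (g ^ 2 ^ (k - 2)) v = v := by
    obtain ⟨b, hb, hsum⟩ := exists_odd_sum_five_pow le_rfl hk
    simp only [Nat.sub_self, pow_zero, one_mul] at hsum
    rw [hgpow hv1, hsum, hs, smul_smul]
    have hhalf : ζ ^ (2 * 2 ^ (k - 2)) = -1 := by
      obtain ⟨m, rfl⟩ := Nat.exists_eq_add_of_le hk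
      refine IsPrimitiveRoot.eq_neg_one_of_two_right ?_
      refine hζ.pow (by positivity) ?_
      rw [Nat.add_sub_cancel_left]
      ring
    have : ζ ^ (1 * (2 * d) * (2 ^ (k - 2) * b) : ℤ) = (-1) ^ d := by
      have e : (1 * (2 * d) * (2 ^ (k - 2) * b) : ℤ) = ((2 * 2 ^ (k - 2) : ℕ) : ℤ) * (b * d) := by
        push_cast; ring
      rw [e, zpow_mul, zpow_natCast, hhalf, zpow_mul, hb.neg_one_zpow, zpow_natCast]
    rw [this, ← mul_pow]
    simp
  refine hasSchurIndex_one_of_eigenvector hR hτ hv ha (Subgroup.closure {g, h})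
    (fun x hx ↦ ?_) fun y z ↦ .inl ?_
  · obtain ⟨y, z, rfl⟩ := Subgroup.exists_eq_of_mem_closure_pair hcomm hx
    obtain ⟨e, he⟩ := hgh y z
    by_cases h1 : (2 : ℤ) ^ k ∣ (-1) ^ z * 5 ^ y - 1
    · left
      obtain ⟨⟨i, rfl⟩, ⟨j, rfl⟩⟩ := two_pow_dvd_neg_one_pow_mul_five_pow_sub_one hk h1
      rw [← two_mul, pow_mul h, hsq, one_pow, mul_one, pow_mul]
      have := apply_pow_of_eigenvector (a := g ^ 2 ^ (k - 2)) (μ := (1 : K)) (x := v)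
        (by rw [hgN, one_smul]) j
      rwa [one_pow, one_smul] at this
    · right
      refine ⟨ζ ^ ((-1) ^ z * 5 ^ y : ℤ), fun h2 ↦ h1 ?_, ?_⟩
      · have := (hζ.zpow_eq_one_iff_dvd ((-1) ^ z * 5 ^ y - 1)).mp
          (by rw [zpow_sub₀ hζ0, h2, zpow_one, div_self hζ0])
        simpa using this
      · rw [he, map_smul, eigenvector_s_pow_mul_t_pow hR hζ0 ha, smul_comm]
  · obtain ⟨e, he⟩ := hgh y z
    refine ⟨g ^ y * h ^ z, mul_mem (pow_mem (Subgroup.subset_closure (by simp)) _)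
      (pow_mem (Subgroup.subset_closure (by simp)) _), ζ ^ (-e), ?_⟩
    rw [he, smul_smul, ← zpow_add₀ hζ0, neg_add_cancel, zpow_zero, one_smul]

/-- Here `H` is cyclic, generated by a twist `g` of `s ^ 2 ^ (j - 2)` with `g ^ 2 ^ (m - j)` fixing
`v`, where `m = max j k`. With `l = min j k`, this power acts on `τ (s ^ y * t ^ z) v` by a scalar
that is trivial only if `(-1) ^ z * 5 ^ y` is `1` modulo `2 ^ l`; such a translate lies, up to
scalars, in the `H`-orbit of `v`. -/
theorem hasSchurIndex_one_of_isPrimitiveRoot (hR : HolomorphRelations n a s t)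
    (hτ : τ.IsIrreducible) (hv : v ≠ 0) (ha : τ a v = ζ • v) {k : ℕ} (hk : 2 ≤ k)
    (hζ : IsPrimitiveRoot ζ (2 ^ k)) {j : ℕ} (hj : 2 ≤ j) {ω : K}
    (hω : IsPrimitiveRoot ω (2 ^ j)) (hs : τ (s ^ 2 ^ (k - 2)) v = ω • v) :
    τ.HasSchurIndex F 1 := by
  have hζ0 : ζ ≠ 0 := hζ.ne_zero (by positivity)
  obtain ⟨m, l, hm, hl, hjm, hkm, hcase₁, hcase₂⟩ : ∃ m l : ℕ, 2 ≤ m ∧ 2 ≤ l ∧ j ≤ m ∧ k ≤ m ∧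
      (j ≤ k → m = k ∧ l = j) ∧ (k ≤ j → m = j ∧ l = k) :=
    ⟨max j k, min j k, by omega, by omega, by omega, by omega, by omega, by omega⟩
  obtain ⟨b, hb, hsum⟩ := exists_odd_sum_five_pow hj hjm
  have hζb : IsPrimitiveRoot (ζ ^ (2 ^ (m - j) * b)) (2 ^ l) := by
    have h1 : IsPrimitiveRoot (ζ ^ 2 ^ (m - j)) (2 ^ l) :=
      hζ.pow (by positivity) (by rw [← pow_add]; congr 1; omega)
    rw [zpow_mul, show (2 : ℤ) ^ (m - j) = ((2 ^ (m - j) : ℕ) : ℤ) by push_cast; rfl, zpow_natCast]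
    refine h1.zpow_of_gcd_eq_one b ?_
    rw [← Int.isCoprime_iff_gcd_eq_one]
    push_cast
    exact (Int.isCoprime_two_right.mpr hb).pow_right
  have hω' : IsPrimitiveRoot (ω ^ 2 ^ (m - k)) (2 ^ l) :=
    hω.pow (by positivity) (by rw [← pow_add]; congr 1; omega)
  -- The exponent `c` makes the scalar from the twist in `g ^ 2 ^ (m - j)` inverse to the eigenvalue
  -- `ω ^ 2 ^ (m - k)` of `s ^ 2 ^ (m - 2)` on `v`.
  obtain ⟨c, -, hc⟩ := hζb.eq_pow_of_pow_eq_one hω'.inv.pow_eq_one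
  set g := s ^ 2 ^ (j - 2) * a ^ (c : ℤ) with hg
  have hv1 : τ a v = ζ ^ (1 : ℤ) • v := by rwa [zpow_one]
  have hsw (y z : ℕ) : τ (s ^ 2 ^ (m - 2)) (τ (s ^ y * t ^ z) v) =
      ω ^ 2 ^ (m - k) • τ (s ^ y * t ^ z) v := by
    have h1 : Commute (s ^ 2 ^ (m - 2)) (s ^ y * t ^ z) :=
      ((Commute.refl s).pow_pow _ _).mul_right ((show Commute s t from hR.s_mul_t).pow_pow _ _)
    rw [← Module.End.mul_apply, ← map_mul, h1.eq, map_mul, Module.End.mul_apply,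
      show 2 ^ (m - 2) = 2 ^ (k - 2) * 2 ^ (m - k) by rw [← pow_add]; congr 1; omega, pow_mul,
      apply_pow_of_eigenvector hs, map_smul]
  have hgw (y z : ℕ) : τ (g ^ 2 ^ (m - j)) (τ (s ^ y * t ^ z) v) =
      ((ω ^ 2 ^ (m - k))⁻¹) ^ ((-1) ^ z * 5 ^ y - 1 : ℤ) • τ (s ^ y * t ^ z) v := by
    rw [apply_s_pow_mul_a_zpow_pow hR hζ0 (eigenvector_s_pow_mul_t_pow hR hζ0 ha y z), hsum,
      ← pow_add, show j - 2 + (m - j) = m - 2 by omega, hsw, smul_smul,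
      zpow_sub₀ (hω'.inv.ne_zero (by positivity)), zpow_one, div_inv_eq_mul]
    congr 2
    rw [← hc, ← zpow_natCast, ← zpow_mul, ← zpow_mul]
    congr 1
    ring
  have hgv : τ (g ^ 2 ^ (m - j)) v = v := by simpa using hgw 0 0
  refine hasSchurIndex_one_of_eigenvector hR hτ hv ha (Subgroup.zpowers g)
    (fun x hx ↦ ?_) fun y z ↦ ?_
  · obtain ⟨y, rfl⟩ := mem_powers_iff_mem_zpowers.mpr hx
    simp only
    by_cases h1 : (2 : ℤ) ^ k ∣ 5 ^ (2 ^ (j - 2) * y) - 1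
    · left
      rw [two_pow_dvd_five_pow_sub_one_iff hk] at h1
      have h2 : 2 ^ (m - j) ∣ y := by
        rcases le_total j k with hjk | hjk
        · rw [show k - 2 = j - 2 + (m - j) by omega, pow_add] at h1
          exact Nat.dvd_of_mul_dvd_mul_left (by positivity) h1
        · rw [show m - j = 0 by omega, pow_zero]
          exact one_dvd y
      obtain ⟨i, rfl⟩ := h2
      rw [pow_mul]
      have := apply_pow_of_eigenvector (a := g ^ 2 ^ (m - j)) (μ := (1 : K)) (x := v)
        (by rw [hgv, one_smul]) i
      rwa [one_pow, one_smul] at this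
    · right
      refine ⟨ζ ^ (5 ^ (2 ^ (j - 2) * y) : ℤ), fun h2 ↦ h1 ?_, ?_⟩
      · have := (hζ.zpow_eq_one_iff_dvd (5 ^ (2 ^ (j - 2) * y) - 1)).mp
          (by rw [zpow_sub₀ hζ0, h2, zpow_one, div_self hζ0])
        simpa using this
      · rw [apply_s_pow_mul_a_zpow_pow hR hζ0 hv1, map_smul, eigenvector_s_pow hR hv1, smul_comm,
          one_mul (5 ^ _ : ℤ)]
  · by_cases h1 : (2 : ℤ) ^ l ∣ (-1) ^ z * 5 ^ y - 1
    · left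
      obtain ⟨⟨i, rfl⟩, hy⟩ := two_pow_dvd_neg_one_pow_mul_five_pow_sub_one hl h1
      rw [← two_mul, pow_mul t, sq, hR.t_mul_t, one_pow, mul_one]
      -- Now `2 ^ (l - 2)` divides `y`: for `j ≤ k`, `s ^ y` is a power of the untwisted generator
      -- of `H`; for `k ≤ j`, it only rescales `v`.
      rcases le_total j k with hjk | hjk
      · rw [show l - 2 = j - 2 by omega] at hy
        obtain ⟨x, rfl⟩ := hy
        refine ⟨g ^ x, Subgroup.npow_mem_zpowers g x, ?_⟩
        rw [apply_s_pow_mul_a_zpow_pow hR hζ0 hv1]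
        refine ⟨(ζ ^ (1 * (c : ℤ) * ∑ l ∈ Finset.range x, (5 : ℤ) ^ (2 ^ (j - 2) * l)))⁻¹, ?_⟩
        rw [smul_smul, inv_mul_cancel₀ (zpow_ne_zero _ hζ0), one_smul]
      · rw [show l - 2 = k - 2 by omega] at hy
        obtain ⟨x, rfl⟩ := hy
        refine ⟨1, one_mem _, ω ^ x, ?_⟩
        rw [pow_mul, apply_pow_of_eigenvector hs, map_one, Module.End.one_apply]
    · right
      refine ⟨_, Subgroup.npow_mem_zpowers g _, _, fun h2 ↦ h1 ?_, hgw y z⟩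
      simpa using (hω'.inv.zpow_eq_one_iff_dvd _).mp h2

theorem hasSchurIndex_one_of_holomorphRelations (hR : HolomorphRelations n a s t)
    (hτ : τ.IsIrreducible) : τ.HasSchurIndex F 1 := by
  have := hτ.finiteDimensional
  have := hτ.nontrivial
  obtain ⟨v₁, hv₁⟩ := exists_ne (0 : V)
  obtain ⟨ζ, v, -, hv, ha⟩ := Module.End.exists_eigenvector_mem (τ a) ⊤
    ⟨v₁, Submodule.mem_top, hv₁⟩ (fun _ _ ↦ Submodule.mem_top)
  obtain ⟨k, -, hk⟩ := (Nat.dvd_prime_pow Nat.prime_two).mp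
    (orderOf_dvd_of_pow_eq_one (pow_eq_one_of_eigenvector ha hv hR.a_pow))
  have hζ : IsPrimitiveRoot ζ (2 ^ k) := hk ▸ IsPrimitiveRoot.orderOf ζ
  have hζ0 : ζ ≠ 0 := hζ.ne_zero (by positivity)
  rcases lt_or_ge k 2 with hk2 | hk2
  · refine hasSchurIndex_one_of_sq_eq_one hR hτ hv ha ?_
    rw [hζ.pow_eq_one_iff_dvd]
    exact (pow_dvd_pow 2 (show k ≤ 1 by omega))
  have hp (x : V) : x ∈ Module.End.eigenspace (τ a) ζ ↔ τ a x = ζ • x :=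
    Module.End.mem_eigenspace_iff
  -- Since `5 ^ 2 ^ (k - 2)` is `1` modulo `2 ^ k`, this power of `s` preserves the `ζ`-eigenspace
  -- of `a`.
  obtain ⟨ω, w, hwp, hw, hs⟩ := Module.End.exists_eigenvector_mem (τ (s ^ 2 ^ (k - 2)))
    (Module.End.eigenspace (τ a) ζ) ⟨v, (hp v).mpr ha, hv⟩ (fun x hx ↦ by
      rw [hp] at hx ⊢
      have h1 : ζ ^ ((5 : ℤ) ^ 2 ^ (k - 2)) = ζ := by
        have := (hζ.zpow_eq_one_iff_dvd (5 ^ 2 ^ (k - 2) - 1)).mpr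
          (by simpa using (two_pow_dvd_five_pow_sub_one_iff hk2 (2 ^ (k - 2))).mpr dvd_rfl)
        rwa [zpow_sub₀ hζ0, zpow_one, div_eq_one_iff_eq hζ0] at this
      rw [eigenvector_s_pow hR (u := 1) (by rwa [zpow_one]), one_mul, h1])
  rw [hp] at hwp
  obtain ⟨j, -, hj⟩ := (Nat.dvd_prime_pow Nat.prime_two).mp
    (orderOf_dvd_of_pow_eq_one (pow_eq_one_of_eigenvector hs hw (i := 2 ^ n)
      (by rw [← pow_mul, mul_comm, pow_mul, hR.s_pow, one_pow])))
  have hω : IsPrimitiveRoot ω (2 ^ j) := hj ▸ IsPrimitiveRoot.orderOf ω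
  rcases lt_or_ge j 2 with hj2 | hj2
  · have h2 : ω ^ 2 = 1 := by
      rw [hω.pow_eq_one_iff_dvd]
      exact (pow_dvd_pow 2 (show j ≤ 1 by omega))
    obtain ⟨d, rfl⟩ : ∃ d : ℕ, ω = (-1) ^ d := by
      rcases sq_eq_one_iff.mp h2 with h | h
      · exact ⟨0, by simpa using h⟩
      · exact ⟨1, by simpa using h⟩
    exact hasSchurIndex_one_of_eq_neg_one_pow hR hτ hw hwp hk2 hζ d hs
  · exact hasSchurIndex_one_of_isPrimitiveRoot hR hτ hw hwp hk2 hζ hj2 hω hs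

end SchurIndex

end Representation

/-! ### Verification of the relations in the holomorph -/

/-- Multiplication by units, as automorphisms of the multiplicative version of `ZMod N`. -/
def ZMod.unitsMulAut (N : ℕ) : (ZMod N)ˣ →* MulAut (Multiplicative (ZMod N)) where
  toFun u :=
    { toFun := fun x ↦ Multiplicative.ofAdd (u * x.toAdd)
      invFun := fun x ↦ Multiplicative.ofAdd (↑u⁻¹ * x.toAdd)
      left_inv := fun x ↦ by simp
      right_inv := fun x ↦ by simp
      map_mul' := fun x y ↦ by simp [mul_add] }
  map_one' := by ext x; simp
  map_mul' u v := by ext x; simp [mul_assoc]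

@[simp] theorem ZMod.unitsMulAut_apply (N : ℕ) (u : (ZMod N)ˣ) (x : Multiplicative (ZMod N)) :
    ZMod.unitsMulAut N u x = Multiplicative.ofAdd (u * x.toAdd) := rfl

/-- An endomorphism is multiplication by its value at the generator; the inverse automorphism
supplies the inverse unit. -/
theorem ZMod.unitsMulAut_surjective (N : ℕ) : Function.Surjective (ZMod.unitsMulAut N) := by
  intro φ
  have h (ψ : MulAut (Multiplicative (ZMod N))) (x : ZMod N) :
      (ψ (Multiplicative.ofAdd x)).toAdd = (ψ (Multiplicative.ofAdd 1)).toAdd * x := by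
    have : Multiplicative.ofAdd x = Multiplicative.ofAdd (1 : ZMod N) ^ (x.cast : ℤ) := by
      rw [← ofAdd_zsmul, zsmul_one, ZMod.intCast_zmod_cast]
    rw [this, map_zpow, toAdd_zpow, zsmul_eq_mul, ZMod.intCast_zmod_cast, mul_comm]
  refine ⟨Units.mkOfMulEqOne (φ (Multiplicative.ofAdd 1)).toAdd
    (φ⁻¹ (Multiplicative.ofAdd 1)).toAdd ?_, ?_⟩
  · rw [← h]
    simp
  · ext x
    exact congrArg Multiplicative.ofAdd (h φ x.toAdd).symm

/-- A unit is odd, hence `1` modulo `4` up to sign, and then a power of `5⁻¹`. -/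
theorem ZMod.exists_units_two_pow_eq {n : ℕ} (hn : 1 ≤ n) {v : (ZMod (2 ^ n))ˣ}
    (hv : (v : ZMod (2 ^ n)) = 5) (u : (ZMod (2 ^ n))ˣ) : ∃ y z : ℕ, u = v⁻¹ ^ y * (-1) ^ z := by
  have hodd : Odd ((u : ZMod (2 ^ n)).val) := by
    have := ZMod.val_coe_unit_coprime u
    exact Nat.coprime_two_right.mp (this.coprime_dvd_right (dvd_pow_self 2 (by omega)))
  obtain ⟨z, hz⟩ : ∃ z : ℕ, (-1) ^ z * ((u : ZMod (2 ^ n)).val : ℤ) ≡ 1 [ZMOD 4] := by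
    obtain ⟨r, hr⟩ := hodd
    rw [hr]
    rcases Nat.even_or_odd' r with ⟨q, rfl | rfl⟩
    · refine ⟨0, Int.modEq_iff_dvd.mpr ⟨-q, by push_cast; ring⟩⟩
    · refine ⟨1, Int.modEq_iff_dvd.mpr ⟨q + 1, by push_cast; ring⟩⟩
  obtain ⟨y, hy⟩ := exists_mul_five_pow_modEq_one hz n
  have h := (ZMod.intCast_zmod_eq_zero_iff_dvd _ (2 ^ n)).mpr (by exact_mod_cast hy)
  push_cast at h
  rw [ZMod.natCast_zmod_val, sub_eq_zero, ← hv] at h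
  have h1 : (-1) ^ z * u * v ^ y = 1 := Units.ext (by push_cast; exact h)
  refine ⟨y, z, ?_⟩
  have h2 : ((-1) ^ z : (ZMod (2 ^ n))ˣ) * (-1) ^ z = 1 := by rw [← mul_pow]; simp
  rw [inv_pow, eq_inv_mul_iff_mul_eq]
  calc v ^ y * u = ((-1) ^ z * (-1) ^ z) * (v ^ y * u) := by rw [h2, one_mul]
    _ = (-1) ^ z * ((-1) ^ z * u * v ^ y) := by rw [mul_assoc, mul_comm (v ^ y), mul_assoc ((-1) ^ z)]
    _ = (-1) ^ z := by rw [h1, mul_one]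

theorem Holomorph.exists_relations {n : ℕ} (hn : 1 ≤ n) :
    ∃ a s t : Holomorph (Multiplicative (ZMod (2 ^ n))), HolomorphRelations n a s t := by
  have hcop : Nat.Coprime 5 (2 ^ n) := Nat.Coprime.pow_right n (by norm_num)
  let v := ZMod.unitOfCoprime 5 hcop
  have hv : (v : ZMod (2 ^ n)) = 5 := by simp [v]
  let U := ZMod.unitsMulAut (2 ^ n)
  let A : Multiplicative (ZMod (2 ^ n)) →* Holomorph (Multiplicative (ZMod (2 ^ n))) :=
    SemidirectProduct.inl
  let B : MulAut (Multiplicative (ZMod (2 ^ n))) →* Holomorph (Multiplicative (ZMod (2 ^ n))) :=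
    SemidirectProduct.inr
  have hBA (φ : MulAut (Multiplicative (ZMod (2 ^ n)))) (x : Multiplicative (ZMod (2 ^ n))) :
      A (φ x) * B φ = B φ * A x := by
    have : A (φ x) = B φ * A x * B φ⁻¹ := SemidirectProduct.inl_aut (φ := MonoidHom.id _) φ x
    rw [this, map_inv, inv_mul_cancel_right]
  have hvpow : v ^ 2 ^ n = 1 := by
    have h := (ZMod.intCast_zmod_eq_zero_iff_dvd (5 ^ 2 ^ n - 1) (2 ^ n)).mpr (by
      have := (two_pow_dvd_five_pow_sub_one_iff (k := n + 2) (by omega) (2 ^ n)).mpr (by simp)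
      exact_mod_cast (pow_dvd_pow (2 : ℤ) (show n ≤ n + 2 by omega)).trans this)
    push_cast at h
    exact Units.ext (by push_cast; rw [hv]; exact sub_eq_zero.mp h)
  -- Conjugation by `B φ` acts as `φ`, so `s⁻¹ * a * s = a ^ 5` forces `s` to be multiplication by
  -- `5⁻¹`.
  refine ⟨A (Multiplicative.ofAdd 1), B (U v⁻¹), B (U (-1)), ?_, ?_, ?_, ?_, ?_, ?_, fun g ↦ ?_⟩
  · rw [← map_pow, ← ofAdd_nsmul, nsmul_one, ZMod.natCast_self, ofAdd_zero, map_one]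
  · rw [← map_pow, ← map_pow, inv_pow, hvpow, inv_one, map_one, map_one]
  · rw [← map_mul, ← map_mul, neg_one_mul, neg_neg, map_one, map_one]
  · rw [← map_mul, ← map_mul, ← map_mul, ← map_mul, mul_comm]
  · have h5 : U v⁻¹ (Multiplicative.ofAdd 1 ^ 5) = Multiplicative.ofAdd 1 := by
      rw [← ofAdd_nsmul, ZMod.unitsMulAut_apply, toAdd_ofAdd, nsmul_one, Nat.cast_ofNat, ← hv,
        Units.inv_mul]
    rw [← map_pow, ← hBA, h5]
  · have h1 : U (-1) (Multiplicative.ofAdd 1)⁻¹ = Multiplicative.ofAdd 1 := by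
      rw [← ofAdd_neg]
      simp [U]
    rw [← map_inv, ← hBA, h1]
  · obtain ⟨u, hu⟩ := ZMod.unitsMulAut_surjective (2 ^ n) g.right
    obtain ⟨y, z, rfl⟩ := ZMod.exists_units_two_pow_eq hn hv u
    have : NeZero (2 ^ n) := ⟨pow_ne_zero n two_ne_zero⟩
    set u := v⁻¹ ^ y * (-1) ^ z with hu'
    have hx (x : Multiplicative (ZMod (2 ^ n))) :
        Multiplicative.ofAdd (1 : ZMod (2 ^ n)) ^ x.toAdd.val = x := by
      rw [← ofAdd_nsmul, nsmul_one, ZMod.natCast_zmod_val, ofAdd_toAdd]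
    have hB : B (U v⁻¹) ^ y * B (U (-1)) ^ z = B (U u) := by simp only [hu', map_mul, map_pow]
    have hg : g = A g.left * B (U u) := by
      rw [hu]
      exact (SemidirectProduct.inl_left_mul_inr_right g).symm
    refine ⟨((U u)⁻¹ g.left).toAdd.val, y, z, ?_⟩
    rw [← map_pow A, hx, hB, ← hBA, MulAut.apply_inv_self]
    exact hg

theorem lemma9p2p1 (n : ℕ) (hn : 1 ≤ n) {V : Type*} [AddCommGroup V] [Module ℂ V]
    (τ : Representation ℂ (Holomorph (Multiplicative (ZMod (2 ^ n)))) V) (hτ : τ.IsIrreducible) :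
    τ.HasSchurIndex ℚ 1 := by
  have : NeZero (2 ^ n) := ⟨by positivity⟩
  have : Finite (Multiplicative (ZMod (2 ^ n))) := inferInstanceAs (Finite (ZMod (2 ^ n)))
  have : Finite (MulAut (Multiplicative (ZMod (2 ^ n)))) := DFunLike.finite _
  have : Finite (Holomorph (Multiplicative (ZMod (2 ^ n)))) :=
    Finite.of_equiv _ SemidirectProduct.equivProd.symm
  obtain ⟨a, s, t, hR⟩ := Holomorph.exists_relations hn
  exact Representation.hasSchurIndex_one_of_holomorphRelations hR hτ
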